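/- Let $d\ge 1$, let $\mu=(\mu_1,\dots,\mu_d)$ be a permuted partition of $n$, i.e. non-negative integers in any order with $\sum_i\mu_i=n$, at least two of them non-zero, and let $p\in[0,1]$. Write $\binom n\mu=\frac{n!}{\mu_1!\cdots\mu_d!}$, $p^*(\mu)=\frac1{1+\binom n\mu}$, and $|w_\mu\rangle=|1\rangle^{\otimes\mu_1}\otimes\cdots\otimes|d\rangle^{\otimes\mu_d}\in(\mathbb C^d)^{\otimes n}$. For $\pi\in S_n$ let $\psi(\pi)$ permute the tensor factors, $\psi(\pi)|x_1\dots x_n\rangle=|x_{\pi^{-1}(1)}\dots x_{\pi^{-1}(n)}\rangle$, and let $\Pi_{(n)}=\frac1{n!}\sum_{\pi\in S_n}\psi(\pi)$ be the projector onto the symmetric subspace. A test is an operator $\Pi_=$ with $0\preceq\Pi_=\preceq\mathbb 1$; applied to an "equal" state $\rho_=$, which occurs with probability $p$, and a "not equal" state $\rho_{\neq}$, which occurs with probability $1-p$, it has completeness $\mathbb P_c=\operatorname{Tr}[\Pi_=\rho_=]$, soundness $\mathbb P_s=\operatorname{Tr}[(\mathbb 1-\Pi_=)\rho_{\neq}]$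 and average success probability $\mathbb P_{succ}=p\,\mathbb P_c+(1-p)\,\mathbb P_s$. Consider two versions of the problem with permuted inputs. (a) Random: with Haar measure $dU$ on $U(d)$, $$\rho_==\int U^{\otimes n}|1^n\rangle\langle1^n|U^{\dagger\otimes n}\,dU,\qquad \rho_{\neq}=\frac1{n!}\sum_{\pi\in S_n}\psi(\pi)\Big(\int U^{\otimes n}|w_\mu\rangle\langle w_\mu|U^{\dagger\otimes n}\,dU\Big)\psi(\pi)^{-1};$$ a test is optimal if it maximizes $\mathbb P_{succ}$ over all tests. (b) Unknown: for an unknown Borel probability measure $q$ on $U(d)\times S_n$, $$\rho_==\int U^{\otimes n}|1^n\rangle\langle1^n|U^{\dagger\otimes n}\,dq(U,\sigma),\qquad \rho_{\neq}=\int\psi(\sigma)U^{\otimes n}|w_\mu\rangle\langle w_\mu|U^{\dagger\otimes n}\psi(\sigma)^{-1}\,dq(U,\sigma);$$ a test is optimal if it maximizes $\inf_q\mathbb P_{succ}$ over all tests. Then, in both versions: 1. If $p\ge p^*(\mu)$, the permutation test $\Pi_==\Pi_{(n)}$ is optimal, with $\mathbb P_{succ}=1-\frac{1-p}{\binom n\mu}$,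 $\mathbb P_c=1$ and $\mathbb P_s=1-\frac1{\binom n\mu}$ (in (b), for every $q$). 2. If $p\le p^*(\mu)$, the test $\Pi_==0$ (always answer "not equal") is optimal, with $\mathbb P_{succ}=1-p$, $\mathbb P_c=0$ and $\mathbb P_s=1$ (in (b), for every $q$). Moreover, the same two tests are optimal, for the same ranges of $p$ and with the same success probabilities, for the corresponding problems in which the positions are known (no permutation: in (a), $\rho_{\neq}=\int U^{\otimes n}|w_\mu\rangle\langle w_\mu|U^{\dagger\otimes n}\,dU$; in (b), $q$ is a measure on $U(d)$ and $\sigma$ is the identity). Hence, in each version, the optimal value for permuted inputs equals the one for inputs in known positions: knowing the positions of the differing states gives no advantage. -/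

import Mathlib

open scoped ComplexOrder

noncomputable section

namespace QSI

open MeasureTheory

/-- The unitary group `U(d)`. -/
abbrev UGroup (d : ℕ) : Type := Matrix.unitaryGroup (Fin d) ℂ

/-- Operators on `(ℂ^d)^{⊗ n}`, written in the computational basis, which is indexed by the words
`x₁ x₂ … xₙ` over the alphabet `Fin d`. -/
abbrev Op (d n : ℕ) : Type := Matrix (Fin n → Fin d) (Fin n → Fin d) ℂ

/-! ### Haar measure on `U(d)` -/

instance instMeasurableSpaceUGroup (d : ℕ) : MeasurableSpace (UGroup d) := borel _

instance instBorelSpaceUGroup (d : ℕ) : BorelSpace (UGroup d) := ⟨rfl⟩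

theorem isCompact_unitaryGroup (d : ℕ) :
    IsCompact ((Matrix.unitaryGroup (Fin d) ℂ : Submonoid (Matrix (Fin d) (Fin d) ℂ)) :
      Set (Matrix (Fin d) (Fin d) ℂ)) := by
  have hK : IsCompact (Set.univ.pi fun _ : Fin d => Set.univ.pi fun _ : Fin d =>
      Metric.closedBall (0 : ℂ) 1) :=
    isCompact_univ_pi fun _ => isCompact_univ_pi fun _ => isCompact_closedBall _ _
  refine IsCompact.of_isClosed_subset hK isClosed_unitary ?_
  intro U hU i _ j _
  rw [mem_closedBall_zero_iff]
  exact entry_norm_bound_of_unitary hU i j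

instance instCompactSpaceUGroup (d : ℕ) : CompactSpace (UGroup d) :=
  isCompact_iff_compactSpace.mp (isCompact_unitaryGroup d)

/-- The Haar measure on `U(d)`, of total mass one. -/
def haarU (d : ℕ) : Measure (UGroup d) := Measure.haarMeasure ⊤

/-- Every set of permutations is measurable. -/
instance instMeasurableSpacePerm (n : ℕ) : MeasurableSpace (Equiv.Perm (Fin n)) := ⊤

/-! ### Operators -/

/-- `U^{⊗ n}`. -/
def tensorPow {d : ℕ} (n : ℕ) (U : Matrix (Fin d) (Fin d) ℂ) : Op d n :=
  Matrix.of fun x y => ∏ k, U (x k) (y k)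

/-- The operator `ψ(π)` that permutes the registers:
`ψ(π) |y₁ … yₙ⟩ = |y_{π⁻¹(1)} … y_{π⁻¹(n)}⟩`. -/
def permOp (d : ℕ) {n : ℕ} (π : Equiv.Perm (Fin n)) : Op d n :=
  Matrix.of fun x y => if x = y ∘ ⇑π⁻¹ then 1 else 0

/-- The projector `Π_(n) = (1/n!) ∑_π ψ(π)` onto the symmetric subspace; as a measurement operator
it is the outcome "equal" of the permutation test. -/
def symProj (d n : ℕ) : Op d n :=
  ((n.factorial : ℂ)⁻¹) • ∑ π : Equiv.Perm (Fin n), permOp d π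

/-- The density operator `U^{⊗ n} |w⟩⟨w| (U†)^{⊗ n}` for a word `w`. -/
def rotated {d n : ℕ} (w : Fin n → Fin d) (U : UGroup d) : Op d n :=
  tensorPow n (U : Matrix (Fin d) (Fin d) ℂ) * Matrix.single w w 1 *
    (tensorPow n (U : Matrix (Fin d) (Fin d) ℂ)).conjTranspose

/-- The mixture `∫ ρ_ω dq(ω)` of a family of operators, entry by entry. -/
def mix {Ω : Type*} [MeasurableSpace Ω] {d n : ℕ} (q : Measure Ω) (ρ : Ω → Op d n) : Op d n :=
  Matrix.of fun x y => ∫ ω, ρ ω x y ∂q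

/-- The word `1ⁿ`. -/
def constWord (d n : ℕ) [NeZero d] : Fin n → Fin d := fun _ => 0

/-- The word `1^{μ₁} 2^{μ₂} … d^{μ_d}`: first `μ₁` letters `1`, then `μ₂` letters `2`, etc. -/
def blockWord {d n : ℕ} (μ : Fin d → ℕ) (hμ : ∑ i, μ i = n) : Fin n → Fin d :=
  fun k => (finSigmaFinEquiv.symm (Fin.cast hμ.symm k)).1

/-- The multinomial coefficient `n! / (μ₁! ⋯ μ_d!)`, where `n = ∑ μ_i`, as a real number. -/
def multinom {d : ℕ} (μ : Fin d → ℕ) : ℝ := (Nat.multinomial Finset.univ μ : ℝ)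

/-- The threshold prior `p*(μ)`. -/
def pStar {d : ℕ} (μ : Fin d → ℕ) : ℝ := 1 / (1 + multinom μ)

/-! ### The Haar-random states -/

/-- `ρ₌ⁿ`. -/
def rhoEq (d n : ℕ) [NeZero d] : Op d n := mix (haarU d) (rotated (constWord d n))

/-- `ρ_≠^μ` : the order of the input is known. -/
def rhoNeq {d n : ℕ} (μ : Fin d → ℕ) (hμ : ∑ i, μ i = n) : Op d n :=
  mix (haarU d) (rotated (blockWord μ hμ))

/-- `ρ̃_≠^μ` : the input is permuted by a uniformly random permutation. -/
def rhoNeqPerm {d n : ℕ} (μ : Fin d → ℕ) (hμ : ∑ i, μ i = n) : Op d n :=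
  ((n.factorial : ℂ)⁻¹) •
    ∑ π : Equiv.Perm (Fin n), permOp d π * rhoNeq μ hμ * permOp d π⁻¹

/-! ### Tests and their success probabilities -/

/-- `E` is the outcome "equal" of a two-outcome POVM `{E, 1 - E}`. -/
def IsTest {d n : ℕ} (E : Op d n) : Prop := E.PosSemidef ∧ (1 - E).PosSemidef

/-- The probability `Tr[E ρ]` of the outcome `E` in the state `ρ`. -/
def prob {d n : ℕ} (E ρ : Op d n) : ℝ := (E * ρ).trace.re

/-- The success probability of the test `{E, 1 - E}` when the state is `ρ₀` ("equal") with
probability `p` and `ρ₁` ("not equal") with probability `1 - p`. -/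
def success {d n : ℕ} (p : ℝ) (ρ₀ ρ₁ E : Op d n) : ℝ :=
  p * prob E ρ₀ + (1 - p) * prob (1 - E) ρ₁

/-- A problem is a family of scenarios `i`, each with its "equal" state `(S i).1` and its
"not equal" state `(S i).2`; the tester does not know the scenario. The value of a test is its
success probability in the worst scenario. -/
def value {ι : Type} {d n : ℕ} (p : ℝ) (S : ι → Op d n × Op d n) (E : Op d n) : ℝ :=
  ⨅ i, success p (S i).1 (S i).2 E

/-- The optimal value of a problem over all tests. -/
def optValue {ι : Type} {d n : ℕ} (p : ℝ) (S : ι → Op d n × Op d n) : ℝ :=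
  ⨆ E : {E : Op d n // IsTest E}, value p S E.1

/-- The test `E` is optimal for the problem `S` with prior `p`. Its value is `Psucc`, and in every
scenario its completeness, soundness and average success probabilities are `Pc`, `Ps`, `Psucc`. -/
structure IsOptimalWith {ι : Type} {d n : ℕ} (p : ℝ) (S : ι → Op d n × Op d n) (E : Op d n)
    (Psucc Pc Ps : ℝ) : Prop where
  isTest : IsTest E
  optimal : ∀ F : Op d n, IsTest F → value p S F ≤ value p S E
  value_eq : value p S E = Psucc
  success_eq : ∀ i, success p (S i).1 (S i).2 E = Psucc
  completeness : ∀ i, prob E (S i).1 = Pc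
  soundness : ∀ i, prob (1 - E) (S i).2 = Ps

/-! ### The problems

In the Haar-random versions there is a single scenario. In the versions with an unknown unitary
(and an unknown permutation), the scenarios are all Borel probability distributions of the unitary
(jointly with the permutation). -/

/-- Known order, Haar-random unitary. -/
def haarOrdered {d n : ℕ} [NeZero d] (μ : Fin d → ℕ) (hμ : ∑ i, μ i = n) :
    Unit → Op d n × Op d n :=
  fun _ => (rhoEq d n, rhoNeq μ hμ)

/-- Uniformly random order, Haar-random unitary. -/
def haarPermuted {d n : ℕ} [NeZero d] (μ : Fin d → ℕ) (hμ : ∑ i, μ i = n) :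
    Unit → Op d n × Op d n :=
  fun _ => (rhoEq d n, rhoNeqPerm μ hμ)

/-- Known order, unknown unitary. -/
def unknownOrdered {d n : ℕ} [NeZero d] (μ : Fin d → ℕ) (hμ : ∑ i, μ i = n) :
    ProbabilityMeasure (UGroup d) → Op d n × Op d n :=
  fun q => (mix (q : Measure (UGroup d)) (rotated (constWord d n)),
    mix (q : Measure (UGroup d)) (rotated (blockWord μ hμ)))

/-- Unknown unitary `U` and unknown permutation `σ`. In the "not equal" case the input
`|ψ₁ … ψₙ⟩` satisfies `|ψ_{σ(1)} … ψ_{σ(n)}⟩ = U^{⊗ n} |1^{μ₁} … d^{μ_d}⟩`, that is, it is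
`ψ(σ) U^{⊗ n} |1^{μ₁} … d^{μ_d}⟩`. -/
def unknownPermuted {d n : ℕ} [NeZero d] (μ : Fin d → ℕ) (hμ : ∑ i, μ i = n) :
    ProbabilityMeasure (UGroup d × Equiv.Perm (Fin n)) → Op d n × Op d n :=
  fun q => (mix (q : Measure (UGroup d × Equiv.Perm (Fin n)))
      (fun ω => rotated (constWord d n) ω.1),
    mix (q : Measure (UGroup d × Equiv.Perm (Fin n)))
      (fun ω => permOp d ω.2 * rotated (blockWord μ hμ) ω.1 * permOp d ω.2⁻¹))

end QSI

end

open scoped ComplexOrder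

namespace QSI

open MeasureTheory Matrix

/-! ### Permutations of the registers -/

/-! Write `M` for the multinomial coefficient, `R` for the Haar-random "equal" state, `A` for the
Haar-random "not equal" state in known positions, `w` for the block word and `Π` for the symmetric
projector. Everything rests on the operator inequality `A ⪰ R / M`, tested against positive
semidefinite `E` in `prob_rhoNeq_ge`. It bounds the success probability of a test `E` by `(1 - p) +
(p - (1 - p) / M) Tr[E R]`, which is affine in `Tr[E R] ∈ [0, 1]`. The slope changes sign exactly at
`p = 1 / (1 + M)`: above this prior the bound is largest at `Tr[E R] = 1`, attained by `Π`; below it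
at `Tr[E R] = 0`, attained by the zero test.

The inequality needs no decomposition into irreducibles. An operator commuting with all `U^{⊗ n}`
preserves the weight spaces of the diagonal unitaries, so `|1ⁿ⟩`, alone in its weight space, is an
eigenvector; by invariance so is every `U^{⊗ n} |1ⁿ⟩`. Hence `R² = c R` and `A R = R A = r R` with
scalars `c`, `r`. Computing `Tr[A R]` in two ways gives `r = R w w`, and the diagonal entry of `R²`
at `w` gives `c = M r`. Compressing `A` by the projection `1 - R / c` leaves `A - R / M`, which is
therefore positive.

Random permutations preserve the bound because they fix `R`. For unknown inputs, the single scenario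
of a Haar-random unitary with the identity permutation already bounds the worst case, while `Π` and
`0` perform equally well in all scenarios. -/

theorem permOp_mul_apply {d n : ℕ} (π : Equiv.Perm (Fin n)) (B : Op d n) (x y : Fin n → Fin d) :
    (permOp d π * B) x y = B (x ∘ π) y := by
  have h : ∀ z : Fin n → Fin d, x = z ∘ ⇑π⁻¹ ↔ z = x ∘ π := by
    intro z
    constructor
    · rintro rfl; ext k; simp
    · rintro rfl; ext k; simp
  simp only [Matrix.mul_apply, permOp, Matrix.of_apply, h]
  simp

theorem mul_permOp_apply {d n : ℕ} (π : Equiv.Perm (Fin n)) (B : Op d n) (x y : Fin n → Fin d) :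
    (B * permOp d π) x y = B x (y ∘ ⇑π⁻¹) := by
  simp [Matrix.mul_apply, permOp]

theorem permOp_mul (d : ℕ) {n : ℕ} (π σ : Equiv.Perm (Fin n)) :
    permOp d π * permOp d σ = permOp d (π * σ) := by
  ext x y
  rw [mul_permOp_apply]
  simp only [permOp, Matrix.of_apply, _root_.mul_inv_rev, Equiv.Perm.coe_mul, Function.comp_assoc]

theorem permOp_one (d n : ℕ) : permOp d (1 : Equiv.Perm (Fin n)) = 1 := by
  ext x y
  simp [permOp, Matrix.one_apply]

theorem permOp_conjTranspose (d : ℕ) {n : ℕ} (π : Equiv.Perm (Fin n)) :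
    (permOp d π)ᴴ = permOp d π⁻¹ := by
  ext x y
  have h : y = x ∘ ⇑π⁻¹ ↔ x = y ∘ π := by
    constructor
    · rintro rfl; ext k; simp
    · rintro rfl; ext k; simp
  simp only [permOp, Matrix.conjTranspose_apply, Matrix.of_apply, inv_inv, h]
  split_ifs <;> simp

theorem permOp_inv_mul_permOp (d : ℕ) {n : ℕ} (π : Equiv.Perm (Fin n)) :
    permOp d π⁻¹ * permOp d π = 1 := by
  rw [permOp_mul, inv_mul_cancel, permOp_one]

theorem permOp_mul_symProj (d : ℕ) {n : ℕ} (σ : Equiv.Perm (Fin n)) :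
    permOp d σ * symProj d n = symProj d n := by
  simp only [symProj, Matrix.mul_smul, Finset.mul_sum, permOp_mul]
  congr 1
  exact Fintype.sum_equiv (Equiv.mulLeft σ) _ _ fun _ => rfl

theorem symProj_mul_permOp (d : ℕ) {n : ℕ} (σ : Equiv.Perm (Fin n)) :
    symProj d n * permOp d σ = symProj d n := by
  simp only [symProj, Matrix.smul_mul, Finset.sum_mul, permOp_mul]
  congr 1
  exact Fintype.sum_equiv (Equiv.mulRight σ) _ _ fun _ => rfl

theorem symProj_mul_eq {d n : ℕ} {B : Op d n} (h : ∀ π : Equiv.Perm (Fin n), permOp d π * B = B) :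
    symProj d n * B = B := by
  have h0 : (n.factorial : ℂ) ≠ 0 := by exact_mod_cast n.factorial_ne_zero
  simp [symProj, Finset.sum_mul, h, Fintype.card_perm, ← Nat.cast_smul_eq_nsmul ℂ,
    smul_smul, h0]

theorem symProj_mul_self (d n : ℕ) : symProj d n * symProj d n = symProj d n :=
  symProj_mul_eq (permOp_mul_symProj d)

theorem symProj_conjTranspose (d n : ℕ) : (symProj d n)ᴴ = symProj d n := by
  simp only [symProj, Matrix.conjTranspose_smul, Matrix.conjTranspose_sum, permOp_conjTranspose]
  congr 1
  · simp
  · exact Fintype.sum_equiv (Equiv.inv _) _ _ fun _ => rfl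

theorem isTest_symProj (d n : ℕ) : IsTest (symProj d n) := by
  constructor
  · have h := Matrix.posSemidef_conjTranspose_mul_self (symProj d n)
    rwa [symProj_conjTranspose, symProj_mul_self] at h
  · have h := Matrix.posSemidef_conjTranspose_mul_self (1 - symProj d n)
    rwa [Matrix.conjTranspose_sub, Matrix.conjTranspose_one, symProj_conjTranspose,
      Matrix.sub_mul, Matrix.one_mul, Matrix.mul_sub, symProj_mul_self, Matrix.mul_one, sub_self,
      sub_zero] at h

theorem isTest_zero (d n : ℕ) : IsTest (0 : Op d n) := by
  refine ⟨Matrix.PosSemidef.zero, ?_⟩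
  rw [sub_zero]
  exact Matrix.PosSemidef.one

/-! ### Tensor powers -/

theorem tensorPow_mul {d : ℕ} (n : ℕ) (U V : Matrix (Fin d) (Fin d) ℂ) :
    tensorPow n U * tensorPow n V = tensorPow n (U * V) := by
  ext x y
  simp only [Matrix.mul_apply, tensorPow, Matrix.of_apply]
  rw [Finset.prod_univ_sum, Fintype.piFinset_univ]
  simp only [Finset.prod_mul_distrib]

theorem tensorPow_one (d n : ℕ) : tensorPow n (1 : Matrix (Fin d) (Fin d) ℂ) = 1 := by
  ext x y
  simp only [tensorPow, Matrix.of_apply, Matrix.one_apply, funext_iff]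
  rw [Finset.prod_boole]
  simp

theorem tensorPow_conjTranspose {d : ℕ} (n : ℕ) (U : Matrix (Fin d) (Fin d) ℂ) :
    (tensorPow n U)ᴴ = tensorPow n Uᴴ := by
  ext x y
  simp [tensorPow, Matrix.conjTranspose_apply]

theorem tensorPow_conjTranspose_mul_self {d : ℕ} (n : ℕ) (U : UGroup d) :
    (tensorPow n (U : Matrix (Fin d) (Fin d) ℂ))ᴴ * tensorPow n (U : Matrix (Fin d) (Fin d) ℂ)
      = 1 := by
  rw [tensorPow_conjTranspose, tensorPow_mul, ← Matrix.star_eq_conjTranspose,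
    Unitary.coe_star_mul_self, tensorPow_one]

theorem permOp_mul_tensorPow {d n : ℕ} (π : Equiv.Perm (Fin n)) (U : Matrix (Fin d) (Fin d) ℂ) :
    permOp d π * tensorPow n U = tensorPow n U * permOp d π := by
  ext x y
  rw [permOp_mul_apply, mul_permOp_apply]
  simp only [tensorPow, Matrix.of_apply, Function.comp_apply]
  exact Fintype.prod_equiv π _ _ fun k => by simp

theorem symProj_mul_tensorPow {d n : ℕ} (U : Matrix (Fin d) (Fin d) ℂ) :
    symProj d n * tensorPow n U = tensorPow n U * symProj d n := by
  simp only [symProj, Matrix.smul_mul, Matrix.mul_smul, Finset.sum_mul, Finset.mul_sum,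
    permOp_mul_tensorPow]

/-! ### Rotated product states -/

/-- Cyclicity moves the rotation from the state to the effect, so an outcome probability becomes a
diagonal entry of the rotated effect. -/
theorem trace_mul_rotated {d n : ℕ} (E : Op d n) (w : Fin n → Fin d) (U : UGroup d) :
    (E * rotated w U).trace = ((tensorPow n (U : Matrix (Fin d) (Fin d) ℂ))ᴴ * E *
      tensorPow n (U : Matrix (Fin d) (Fin d) ℂ)) w w := by
  rw [rotated, ← Matrix.mul_assoc, Matrix.trace_mul_comm, ← Matrix.mul_assoc, ← Matrix.mul_assoc,
    Matrix.trace_mul_single]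
  simp

theorem trace_rotated {d n : ℕ} (w : Fin n → Fin d) (U : UGroup d) : (rotated w U).trace = 1 := by
  rw [← Matrix.one_mul (rotated w U), trace_mul_rotated, Matrix.mul_one,
    tensorPow_conjTranspose_mul_self, Matrix.one_apply_eq]

theorem prob_rotated_nonneg {d n : ℕ} {E : Op d n} (hE : E.PosSemidef) (w : Fin n → Fin d)
    (U : UGroup d) : 0 ≤ prob E (rotated w U) := by
  rw [prob, trace_mul_rotated]
  exact (Complex.le_def.1 (hE.conjTranspose_mul_mul_same _).diag_nonneg).1

theorem rotated_conjTranspose {d n : ℕ} (w : Fin n → Fin d) (U : UGroup d) :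
    (rotated w U)ᴴ = rotated w U := by
  simp [rotated, Matrix.conjTranspose_mul, Matrix.mul_assoc]

theorem rotated_mul_left {d n : ℕ} (w : Fin n → Fin d) (V U : UGroup d) :
    tensorPow n (V : Matrix (Fin d) (Fin d) ℂ) * rotated w U *
      (tensorPow n (V : Matrix (Fin d) (Fin d) ℂ))ᴴ = rotated w (V * U) := by
  simp only [rotated, Submonoid.coe_mul, ← tensorPow_mul, Matrix.conjTranspose_mul,
    Matrix.mul_assoc]

theorem permOp_mul_rotated_constWord {d n : ℕ} [NeZero d] (π : Equiv.Perm (Fin n)) (U : UGroup d) :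
    permOp d π * rotated (constWord d n) U = rotated (constWord d n) U := by
  have h : permOp d π * (Matrix.single (constWord d n) (constWord d n) 1 : Op d n) =
      Matrix.single (constWord d n) (constWord d n) 1 := by
    ext x y
    rw [permOp_mul_apply]
    have hx : constWord d n = x ∘ π ↔ constWord d n = x := by
      constructor
      · intro h; ext k
        simpa [constWord] using congrArg Fin.val (congrFun h (π⁻¹ k))
      · rintro rfl; rfl
    simp [Matrix.single_apply, hx]
  rw [rotated, ← Matrix.mul_assoc, ← Matrix.mul_assoc, permOp_mul_tensorPow,
    Matrix.mul_assoc (tensorPow n _) (permOp d π), h]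

theorem rotated_constWord_mul_permOp {d n : ℕ} [NeZero d] (π : Equiv.Perm (Fin n)) (U : UGroup d) :
    rotated (constWord d n) U * permOp d π = rotated (constWord d n) U := by
  have h := congrArg Matrix.conjTranspose (permOp_mul_rotated_constWord π⁻¹ U)
  rwa [Matrix.conjTranspose_mul, rotated_conjTranspose, permOp_conjTranspose, inv_inv] at h

theorem continuous_rotated_apply {d n : ℕ} (w x y : Fin n → Fin d) :
    Continuous fun U : UGroup d => rotated w U x y := by
  have h : Continuous fun U : UGroup d => tensorPow n (U : Matrix (Fin d) (Fin d) ℂ) := by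
    refine continuous_matrix fun i j => ?_
    simp only [tensorPow, Matrix.of_apply]
    exact continuous_finsetProd _ fun k _ => continuous_subtype_val.matrix_elem _ _
  exact ((h.matrix_mul continuous_const).matrix_mul h.matrix_conjTranspose).matrix_elem x y

/-! ### Probabilities -/

theorem prob_zero {d n : ℕ} (ρ : Op d n) : prob 0 ρ = 0 := by simp [prob]

theorem prob_one_sub {d n : ℕ} (E ρ : Op d n) : prob (1 - E) ρ = ρ.trace.re - prob E ρ := by
  simp [prob, Matrix.sub_mul, Matrix.trace_sub]

theorem prob_conj_permOp {d n : ℕ} (E ρ : Op d n) (π : Equiv.Perm (Fin n)) :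
    prob E (permOp d π * ρ * permOp d π⁻¹) = prob (permOp d π⁻¹ * E * permOp d π) ρ := by
  rw [prob, prob, ← Matrix.mul_assoc, Matrix.trace_mul_comm, ← Matrix.mul_assoc,
    ← Matrix.mul_assoc]

theorem posSemidef_conj_permOp {d n : ℕ} {E : Op d n} (hE : E.PosSemidef)
    (π : Equiv.Perm (Fin n)) : (permOp d π⁻¹ * E * permOp d π).PosSemidef := by
  have h := hE.conjTranspose_mul_mul_same (permOp d π)
  rwa [permOp_conjTranspose] at h

/-! ### Mixtures -/

section Mix

variable {Ω : Type*} [MeasurableSpace Ω] {d n : ℕ} {q : Measure Ω} {ρ : Ω → Op d n}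

theorem mul_mix_mul (B C : Op d n) (h : ∀ x y, Integrable (fun ω => ρ ω x y) q) :
    B * mix q ρ * C = mix q fun ω => B * ρ ω * C := by
  ext x y
  simp only [mix, Matrix.mul_apply, Matrix.of_apply, Finset.sum_mul]
  rw [integral_finsetSum]
  · refine Finset.sum_congr rfl fun i _ => ?_
    rw [integral_finsetSum]
    · simp only [integral_const_mul, integral_mul_const]
    · exact fun j _ => ((h _ _).const_mul _).mul_const _
  · exact fun i _ => integrable_finsetSum _ fun j _ => ((h _ _).const_mul _).mul_const _

theorem mul_mix (B : Op d n) (h : ∀ x y, Integrable (fun ω => ρ ω x y) q) :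
    B * mix q ρ = mix q fun ω => B * ρ ω := by
  simpa using mul_mix_mul B 1 h

theorem mix_mul (C : Op d n) (h : ∀ x y, Integrable (fun ω => ρ ω x y) q) :
    mix q ρ * C = mix q fun ω => ρ ω * C := by
  simpa using mul_mix_mul 1 C h

theorem smul_mix (c : ℂ) : c • mix q ρ = mix q fun ω => c • ρ ω := by
  ext x y
  simp [mix, integral_const_mul]

theorem trace_mul_mix (E : Op d n) (h : ∀ x y, Integrable (fun ω => ρ ω x y) q) :
    (E * mix q ρ).trace = ∫ ω, (E * ρ ω).trace ∂q := by
  simp only [Matrix.trace, Matrix.diag_apply, mix, Matrix.mul_apply, Matrix.of_apply]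
  rw [integral_finsetSum]
  · refine Finset.sum_congr rfl fun i _ => ?_
    rw [integral_finsetSum]
    · simp only [integral_const_mul]
    · exact fun j _ => (h _ _).const_mul _
  · exact fun i _ => integrable_finsetSum _ fun j _ => (h _ _).const_mul _

theorem integrable_trace_mul (E : Op d n) (h : ∀ x y, Integrable (fun ω => ρ ω x y) q) :
    Integrable (fun ω => (E * ρ ω).trace) q := by
  simp only [Matrix.trace, Matrix.diag_apply, Matrix.mul_apply]
  exact integrable_finsetSum _ fun i _ => integrable_finsetSum _ fun j _ => (h _ _).const_mul _

theorem prob_mix (E : Op d n) (h : ∀ x y, Integrable (fun ω => ρ ω x y) q) :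
    prob E (mix q ρ) = ∫ ω, prob E (ρ ω) ∂q := by
  rw [prob, trace_mul_mix E h]
  exact (Complex.reCLM.integral_comp_comm (integrable_trace_mul E h)).symm

theorem prob_mix_nonneg {E : Op d n} (h : ∀ x y, Integrable (fun ω => ρ ω x y) q)
    (h0 : ∀ ω, 0 ≤ prob E (ρ ω)) : 0 ≤ prob E (mix q ρ) := by
  rw [prob_mix E h]
  exact integral_nonneg h0

theorem prob_mix_eq [IsProbabilityMeasure q] {E : Op d n} {c : ℝ}
    (h : ∀ x y, Integrable (fun ω => ρ ω x y) q) (hc : ∀ ω, prob E (ρ ω) = c) :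
    prob E (mix q ρ) = c := by
  simp [prob_mix E h, hc]

theorem trace_mix_eq_one [IsProbabilityMeasure q] (h : ∀ x y, Integrable (fun ω => ρ ω x y) q)
    (h1 : ∀ ω, (ρ ω).trace = 1) : (mix q ρ).trace = 1 := by
  simpa [h1] using trace_mul_mix 1 h

theorem mix_conjTranspose (h : ∀ ω, (ρ ω)ᴴ = ρ ω) : (mix q ρ)ᴴ = mix q ρ := by
  ext x y
  rw [Matrix.conjTranspose_apply, mix, Matrix.of_apply, Matrix.of_apply, ← starRingEnd_apply,
    ← integral_conj]
  refine integral_congr_ae (.of_forall fun ω => ?_)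
  exact congrFun (congrFun (h ω) x) y

end Mix

theorem integrable_rotated {d n : ℕ} (q : Measure (UGroup d)) [IsFiniteMeasure q]
    (w x y : Fin n → Fin d) : Integrable (fun U => rotated w U x y) q :=
  (continuous_rotated_apply w x y).integrable_of_hasCompactSupport
    (HasCompactSupport.of_compactSpace _)

/-- The integrand is continuous only for each fixed permutation. As there are finitely many
permutations, measurability can be checked on each slice, and the sum of the slice bounds is a
global bound. -/
theorem integrable_of_continuous_left {d n : ℕ} (q : Measure (UGroup d × Equiv.Perm (Fin n)))
    [IsFiniteMeasure q] {f : UGroup d × Equiv.Perm (Fin n) → ℂ}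
    (hf : ∀ σ, Continuous fun U => f (U, σ)) : Integrable f q := by
  have hb : ∀ σ, ∃ C, ∀ U, ‖f (U, σ)‖ ≤ C := fun σ => by
    obtain ⟨C, hC⟩ := (isCompact_univ (X := UGroup d)).exists_bound_of_continuousOn
      (hf σ).continuousOn
    exact ⟨C, fun U => hC U trivial⟩
  choose C hC using hb
  refine Integrable.of_bound
    (measurable_from_prod_countable_left fun σ => (hf σ).measurable).aestronglyMeasurable
    (∑ σ, |C σ|) (.of_forall fun ω => ?_)
  calc ‖f ω‖ ≤ C ω.2 := hC ω.2 ω.1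
    _ ≤ |C ω.2| := le_abs_self _
    _ ≤ ∑ σ, |C σ| := Finset.single_le_sum (f := fun σ => |C σ|) (fun _ _ => abs_nonneg _)
        (Finset.mem_univ _)

/-! ### Words and rearrangements -/

theorem card_blockWord_fiber {d n : ℕ} (μ : Fin d → ℕ) (hμ : ∑ i, μ i = n) (i : Fin d) :
    Fintype.card {k // blockWord μ hμ k = i} = μ i := by
  subst hμ
  rw [Fintype.card_congr (β := {a : Σ j : Fin d, Fin (μ j) // a.1 = i})
      ((finSigmaFinEquiv (n := μ)).symm.subtypeEquiv fun k => by simp [blockWord]),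
    Fintype.card_congr (Equiv.sigmaSubtype (β := fun j => Fin (μ j)) i), Fintype.card_fin]

theorem multinom_pos {d : ℕ} (μ : Fin d → ℕ) : 0 < multinom μ :=
  Nat.cast_pos.2 (Nat.multinomial_pos Finset.univ μ)

/-- A permutation fixing the word permutes the positions of each letter separately, so the
stabilizer has order `∏ μ_i!`. -/
theorem card_stabilizer_blockWord {d n : ℕ} (μ : Fin d → ℕ) (hμ : ∑ i, μ i = n) :
    (Fintype.card {π : Equiv.Perm (Fin n) // blockWord μ hμ ∘ π = blockWord μ hμ} : ℝ) *
      multinom μ = n.factorial := by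
  rw [DomMulAct.stabilizer_card, multinom]
  simp only [card_blockWord_fiber]
  have h := Nat.multinomial_spec Finset.univ μ
  rw [hμ] at h
  exact_mod_cast h

theorem symProj_apply {d n : ℕ} (x y : Fin n → Fin d) :
    symProj d n x y = (n.factorial : ℂ)⁻¹ *
      (Fintype.card {π : Equiv.Perm (Fin n) // x ∘ π = y} : ℂ) := by
  have h : ∀ π : Equiv.Perm (Fin n), x = y ∘ ⇑π⁻¹ ↔ x ∘ π = y := fun π => by
    constructor
    · rintro rfl; ext k; simp
    · rintro rfl; ext k; simp
  simp only [symProj, Matrix.smul_apply, Matrix.sum_apply, permOp, Matrix.of_apply, h, smul_eq_mul]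
  rw [Finset.sum_boole, Fintype.card_subtype]

theorem symProj_blockWord {d n : ℕ} (μ : Fin d → ℕ) (hμ : ∑ i, μ i = n) :
    symProj d n (blockWord μ hμ) (blockWord μ hμ) = ((multinom μ)⁻¹ : ℝ) := by
  have h := card_stabilizer_blockWord μ hμ
  have h0 : (n.factorial : ℝ) ≠ 0 := by exact_mod_cast n.factorial_ne_zero
  have hM := (multinom_pos μ).ne'
  rw [symProj_apply, ← Complex.ofReal_natCast, ← Complex.ofReal_natCast, ← Complex.ofReal_inv,
    ← Complex.ofReal_mul]
  congr 1
  field_simp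
  linarith

theorem exists_perm_of_card_fiber_eq {d n : ℕ} {x y : Fin n → Fin d}
    (h : ∀ i, Fintype.card {k // x k = i} = Fintype.card {k // y k = i}) :
    ∃ π : Equiv.Perm (Fin n), x = y ∘ π := by
  let e : ∀ i, {k // x k = i} ≃ {k // y k = i} := fun i => Fintype.equivOfCardEq (h i)
  exact ⟨Equiv.ofFiberEquiv e, funext fun k => (Equiv.ofFiberEquiv_map e k).symm⟩

/-! ### Operators that commute with `U^{⊗ n}` -/

/-- `A` commutes with `U^{⊗ n}` for every unitary `U`. -/
def IsInvariant {d n : ℕ} (A : Op d n) : Prop :=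
  ∀ U : UGroup d, tensorPow n (U : Matrix (Fin d) (Fin d) ℂ) * A =
    A * tensorPow n (U : Matrix (Fin d) (Fin d) ℂ)

theorem tensorPow_diagonal {d n : ℕ} (v : Fin d → ℂ) :
    tensorPow n (Matrix.diagonal v) = Matrix.diagonal fun x : Fin n → Fin d => ∏ k, v (x k) := by
  ext x y
  by_cases h : x = y
  · subst h; simp [tensorPow]
  · obtain ⟨k, hk⟩ := Function.ne_iff.1 h
    rw [Matrix.diagonal_apply_ne _ h, tensorPow, Matrix.of_apply]
    exact Finset.prod_eq_zero (Finset.mem_univ k) (Matrix.diagonal_apply_ne _ hk)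

/-- Diagonal unitaries act on a word by a character depending only on its letter counts; commuting
with them forbids nonzero entries between words of different counts. -/
theorem IsInvariant.exists_perm {d n : ℕ} {A : Op d n} (hA : IsInvariant A) {x y : Fin n → Fin d}
    (hxy : A x y ≠ 0) : ∃ π : Equiv.Perm (Fin n), x = y ∘ π := by
  refine exists_perm_of_card_fiber_eq fun i => ?_
  -- Letter counts lie in `0, …, n`, so order `n + 1` is enough for the powers of `ζ` to tell them
  -- apart.
  have hζ := Complex.isPrimitiveRoot_exp (n + 1) n.succ_ne_zero
  set ζ := Complex.exp (2 * Real.pi * Complex.I / (n + 1 : ℕ))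
  have hn : ‖ζ‖ = 1 := hζ.norm'_eq_one n.succ_ne_zero
  let v : Fin d → ℂ := fun j => if j = i then ζ else 1
  have hv : ∀ j, v j * star (v j) = 1 := fun j => by
    have h1 : ‖v j‖ = 1 := by
      simp only [v]; split_ifs
      · exact hn
      · exact norm_one
    rw [← starRingEnd_apply, Complex.mul_conj, Complex.normSq_eq_norm_sq, h1]
    simp
  have hU : Matrix.diagonal v ∈ Matrix.unitaryGroup (Fin d) ℂ := by
    rw [Matrix.mem_unitaryGroup_iff, Matrix.star_eq_conjTranspose, Matrix.diagonal_conjTranspose,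
      Matrix.diagonal_mul_diagonal]
    simp only [Pi.star_apply, hv, Matrix.diagonal_one]
  have h := congrFun (congrFun (hA ⟨_, hU⟩) x) y
  rw [tensorPow_diagonal, Matrix.diagonal_mul, Matrix.mul_diagonal, mul_comm] at h
  have hp : ∀ z : Fin n → Fin d, ∏ k, v (z k) = ζ ^ Fintype.card {k // z k = i} := fun z => by
    simp only [v]
    rw [Finset.prod_ite, Finset.prod_const, Finset.prod_const_one, mul_one, Fintype.card_subtype]
  have hc : ∀ z : Fin n → Fin d, Fintype.card {k // z k = i} < n + 1 := fun z =>
    Nat.lt_succ_of_le ((Fintype.card_subtype_le _).trans (Fintype.card_fin n).le)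
  rw [hp, hp] at h
  exact hζ.pow_inj (hc x) (hc y) (mul_left_cancel₀ hxy h)

/-- The constant word is its own only rearrangement, so its column in an invariant operator vanishes
off the diagonal. -/
theorem IsInvariant.mul_single {d n : ℕ} [NeZero d] {A : Op d n} (hA : IsInvariant A) :
    A * Matrix.single (constWord d n) (constWord d n) 1 =
      A (constWord d n) (constWord d n) • Matrix.single (constWord d n) (constWord d n) 1 := by
  ext x y
  by_cases hy : y = constWord d n
  · subst hy
    by_cases hx : x = constWord d n
    · subst hx; simp
    · have h0 : A x (constWord d n) = 0 := by
        by_contra h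
        obtain ⟨π, hπ⟩ := hA.exists_perm h
        exact hx hπ
      simp [h0, Ne.symm hx]
  · simp [hy, Matrix.mul_single_apply_of_ne, Ne.symm hy]

theorem IsInvariant.mul_rotated {d n : ℕ} [NeZero d] {A : Op d n} (hA : IsInvariant A)
    (U : UGroup d) : A * rotated (constWord d n) U =
      A (constWord d n) (constWord d n) • rotated (constWord d n) U := by
  rw [rotated, ← Matrix.mul_assoc, ← Matrix.mul_assoc, ← hA U, Matrix.mul_assoc _ A, hA.mul_single,
    Matrix.mul_smul, Matrix.smul_mul]

/-! ### Haar measure -/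

instance instIsProbabilityMeasureHaarU (d : ℕ) : IsProbabilityMeasure (haarU d) :=
  ⟨by
    have h := Measure.haarMeasure_self (K₀ := (⊤ : TopologicalSpace.PositiveCompacts (UGroup d)))
    simpa [haarU] using h⟩

instance instIsMulLeftInvariantHaarU (d : ℕ) : (haarU d).IsMulLeftInvariant := by
  unfold haarU; infer_instance

instance instIsOpenPosMeasureHaarU (d : ℕ) : (haarU d).IsOpenPosMeasure := by
  unfold haarU; infer_instance

/-- Left invariance of Haar measure absorbs conjugation by `V^{⊗ n}`. -/
theorem isInvariant_mix_haarU {d n : ℕ} (w : Fin n → Fin d) :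
    IsInvariant (mix (haarU d) (rotated w)) := by
  intro V
  have h : tensorPow n (V : Matrix (Fin d) (Fin d) ℂ) * mix (haarU d) (rotated w) *
      (tensorPow n (V : Matrix (Fin d) (Fin d) ℂ))ᴴ = mix (haarU d) (rotated w) := by
    rw [mul_mix_mul _ _ (integrable_rotated _ w)]
    simp only [rotated_mul_left]
    ext x y
    exact integral_mul_left_eq_self (fun U => rotated w U x y) V
  conv_rhs => rw [← h]
  rw [Matrix.mul_assoc _ _ (tensorPow n _), tensorPow_conjTranspose_mul_self, Matrix.mul_one]

theorem IsInvariant.mul_rhoEq {d n : ℕ} [NeZero d] {A : Op d n} (hA : IsInvariant A) :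
    A * rhoEq d n = A (constWord d n) (constWord d n) • rhoEq d n := by
  rw [rhoEq, mul_mix _ (integrable_rotated _ _), smul_mix]
  simp only [hA.mul_rotated]

theorem rhoEq_conjTranspose (d n : ℕ) [NeZero d] : (rhoEq d n)ᴴ = rhoEq d n :=
  mix_conjTranspose (rotated_conjTranspose _)

theorem rhoNeq_conjTranspose {d n : ℕ} (μ : Fin d → ℕ) (hμ : ∑ i, μ i = n) :
    (rhoNeq μ hμ)ᴴ = rhoNeq μ hμ :=
  mix_conjTranspose (rotated_conjTranspose _)

theorem permOp_mul_rhoEq {d n : ℕ} [NeZero d] (π : Equiv.Perm (Fin n)) :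
    permOp d π * rhoEq d n = rhoEq d n := by
  rw [rhoEq, mul_mix _ (integrable_rotated _ _)]
  simp only [permOp_mul_rotated_constWord]

theorem rhoEq_mul_permOp {d n : ℕ} [NeZero d] (π : Equiv.Perm (Fin n)) :
    rhoEq d n * permOp d π = rhoEq d n := by
  rw [rhoEq, mix_mul _ (integrable_rotated _ _)]
  simp only [rotated_constWord_mul_permOp]

theorem trace_rhoEq (d n : ℕ) [NeZero d] : (rhoEq d n).trace = 1 :=
  trace_mix_eq_one (integrable_rotated _ _) (trace_rotated _)

/-- The row of `ρ₌` at a word is a multiple of the row of the projector onto the symmetric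
subspace. -/
theorem rhoEq_apply_blockWord {d n : ℕ} [NeZero d] (μ : Fin d → ℕ) (hμ : ∑ i, μ i = n)
    (z : Fin n → Fin d) : rhoEq d n (blockWord μ hμ) z =
      rhoEq d n (blockWord μ hμ) (blockWord μ hμ) * multinom μ *
        symProj d n (blockWord μ hμ) z := by
  have hM : (multinom μ : ℂ) ≠ 0 := by exact_mod_cast (multinom_pos μ).ne'
  by_cases h : ∃ π : Equiv.Perm (Fin n), blockWord μ hμ = z ∘ π
  · obtain ⟨π, hπ⟩ := h
    have hz : z = blockWord μ hμ ∘ ⇑π⁻¹ := by rw [hπ]; ext k; simp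
    -- On rearrangements of the word both rows are constant, since both operators absorb
    -- permutations on the right.
    have h1 : rhoEq d n (blockWord μ hμ) z = rhoEq d n (blockWord μ hμ) (blockWord μ hμ) := by
      conv_rhs => rw [← rhoEq_mul_permOp π, mul_permOp_apply, ← hz]
    have h2 : symProj d n (blockWord μ hμ) z = symProj d n (blockWord μ hμ) (blockWord μ hμ) := by
      conv_rhs => rw [← symProj_mul_permOp d π, mul_permOp_apply, ← hz]
    rw [h1, h2, symProj_blockWord, Complex.ofReal_inv, mul_assoc, mul_inv_cancel₀ hM, mul_one]
  · have h1 : rhoEq d n (blockWord μ hμ) z = 0 := by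
      by_contra hne
      exact h ((isInvariant_mix_haarU (constWord d n)).exists_perm hne)
    have h2 : IsEmpty {π : Equiv.Perm (Fin n) // blockWord μ hμ ∘ π = z} :=
      ⟨fun ⟨π, hπ⟩ => h ⟨π⁻¹, by subst hπ; ext k; simp⟩⟩
    rw [h1, symProj_apply, Fintype.card_eq_zero]
    simp

/-- The diagonal entry of `R²` at `w` is evaluated twice: through `R² = c R`, and through the
proportionality of the rows of `R` and `Π` at `w` together with `Π R = R`. -/
theorem rhoEq_constWord_mul_eq {d n : ℕ} [NeZero d] (μ : Fin d → ℕ) (hμ : ∑ i, μ i = n) :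
    rhoEq d n (constWord d n) (constWord d n) * rhoEq d n (blockWord μ hμ) (blockWord μ hμ) =
      multinom μ * rhoEq d n (blockWord μ hμ) (blockWord μ hμ) ^ 2 := by
  have h := congrFun (congrFun (isInvariant_mix_haarU (constWord d n)).mul_rhoEq
    (blockWord μ hμ)) (blockWord μ hμ)
  rw [Matrix.smul_apply, smul_eq_mul] at h
  change (rhoEq d n * rhoEq d n) _ _ = rhoEq d n _ _ * _ at h
  have hS := congrFun (congrFun (symProj_mul_eq (permOp_mul_rhoEq (d := d) (n := n)))
    (blockWord μ hμ)) (blockWord μ hμ)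
  rw [Matrix.mul_apply] at hS
  rw [← h, Matrix.mul_apply, Finset.sum_congr rfl fun z _ => by
    rw [rhoEq_apply_blockWord μ hμ z, mul_assoc], ← Finset.mul_sum, hS]
  ring

/-! ### The two Haar mixtures compared -/

theorem rotated_apply {d n : ℕ} (w x y : Fin n → Fin d) (U : UGroup d) :
    rotated w U x y = tensorPow n (U : Matrix (Fin d) (Fin d) ℂ) x w *
      star (tensorPow n (U : Matrix (Fin d) (Fin d) ℂ) y w) := by
  rw [rotated, Matrix.mul_apply, Finset.sum_eq_single w]
  · simp
  · intro z _ hz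
    rw [Matrix.mul_single_apply_of_ne _ _ _ _ _ hz, zero_mul]
  · simp

/-- There is a unitary matrix without vanishing entries. -/
theorem exists_unitary_forall_ne_zero (d : ℕ) [NeZero d] :
    ∃ U : UGroup d, ∀ i j, (U : Matrix (Fin d) (Fin d) ℂ) i j ≠ 0 := by
  have hd : (d : ℂ) ≠ 0 := Nat.cast_ne_zero.2 (NeZero.ne d)
  have hI := Complex.I_mul_I
  let J : Matrix (Fin d) (Fin d) ℂ := Matrix.of fun _ _ => (1 : ℂ)
  have hJ : J * J = (d : ℂ) • J := by
    ext i j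
    simp [J, Matrix.mul_apply]
  have hJs : star J = J := by
    ext i j
    simp [J, Matrix.star_apply]
  -- With the rank-one projection `P = J / d`, this is `(1 - P) + i P`, hence unitary. Every entry
  -- has imaginary part `1 / d`.
  have hU : (1 + ((Complex.I - 1) / d) • J : Matrix (Fin d) (Fin d) ℂ) ∈
      Matrix.unitaryGroup (Fin d) ℂ := by
    rw [Matrix.mem_unitaryGroup_iff, star_add, star_one, star_smul, hJs, add_mul, one_mul, mul_add,
      mul_one, Matrix.smul_mul, Matrix.mul_smul, hJ, smul_smul, smul_smul, add_assoc, ← add_smul,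
      ← add_smul]
    have h0 : star ((Complex.I - 1) / (d : ℂ)) + ((Complex.I - 1) / d +
        (Complex.I - 1) / d * star ((Complex.I - 1) / (d : ℂ)) * d) = 0 := by
      simp only [star_div₀, star_sub, star_one, star_natCast, Complex.star_def, Complex.conj_I]
      field_simp
      linear_combination -hI
    rw [h0, zero_smul, add_zero]
  refine ⟨⟨_, hU⟩, fun i j h => ?_⟩
  have h1 : (1 : Matrix (Fin d) (Fin d) ℂ) i j + (Complex.I - 1) / d = 0 := by
    simpa [J] using h
  rw [Matrix.one_apply] at h1
  have h2 := congrArg Complex.im h1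
  split_ifs at h1 h2 <;> simp [NeZero.ne d] at h2

/-- The entry is the Haar integral of the continuous function `|U^{⊗ n} x 1ⁿ|²`, which is positive
at a unitary without zero entries; Haar measure charges open sets. -/
theorem rhoEq_apply_self_ne_zero {d n : ℕ} [NeZero d] (x : Fin n → Fin d) :
    rhoEq d n x x ≠ 0 := by
  let f : UGroup d → ℝ := fun U =>
    Complex.normSq (tensorPow n (U : Matrix (Fin d) (Fin d) ℂ) x (constWord d n))
  have hf : ∀ U, rotated (constWord d n) U x x = (f U : ℂ) := fun U => by
    rw [rotated_apply, ← starRingEnd_apply, Complex.mul_conj]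
  have hc : Continuous f := by
    have h := Complex.continuous_re.comp (continuous_rotated_apply (constWord d n) x x)
    refine h.congr fun U => ?_
    simp [hf]
  obtain ⟨U, hU⟩ := exists_unitary_forall_ne_zero d
  have hU' : f U ≠ 0 := by
    simp only [f, ne_eq, map_eq_zero, tensorPow, Matrix.of_apply]
    exact Finset.prod_ne_zero_iff.2 fun k _ => hU _ _
  have hpos : 0 < ∫ U, f U ∂(haarU d) :=
    hc.integral_pos_of_hasCompactSupport_nonneg_nonzero (HasCompactSupport.of_compactSpace _)
      (fun U => Complex.normSq_nonneg _) hU'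
  have h : rhoEq d n x x = ((∫ U, f U ∂(haarU d) : ℝ) : ℂ) := by
    rw [rhoEq, mix, Matrix.of_apply]
    simp only [hf]
    exact integral_ofReal
  rw [h]
  exact_mod_cast hpos.ne'

/-- Both sides equal `Tr[A R]`: the left by `A R = a R` and `Tr R = 1`, the right because `R`
commutes with `U^{⊗ n}`, so the integrand does not depend on `U`. -/
theorem rhoNeq_constWord {d n : ℕ} [NeZero d] (μ : Fin d → ℕ) (hμ : ∑ i, μ i = n) :
    rhoNeq μ hμ (constWord d n) (constWord d n) =
      rhoEq d n (blockWord μ hμ) (blockWord μ hμ) := by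
  have h1 := congrArg Matrix.trace (isInvariant_mix_haarU (blockWord μ hμ)).mul_rhoEq
  rw [Matrix.trace_smul, trace_rhoEq, smul_eq_mul, mul_one] at h1
  change (rhoNeq μ hμ * rhoEq d n).trace = rhoNeq μ hμ _ _ at h1
  rw [← h1, Matrix.trace_mul_comm, rhoNeq, trace_mul_mix _ (integrable_rotated _ _)]
  have h2 : ∀ U : UGroup d, (rhoEq d n * rotated (blockWord μ hμ) U).trace =
      rhoEq d n (blockWord μ hμ) (blockWord μ hμ) := fun U => by
    rw [trace_mul_rotated, Matrix.mul_assoc, rhoEq, ← isInvariant_mix_haarU (constWord d n) U,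
      ← Matrix.mul_assoc, tensorPow_conjTranspose_mul_self, Matrix.one_mul]
  simp [h2]

theorem prob_rhoNeq_ge {d n : ℕ} [NeZero d] (μ : Fin d → ℕ) (hμ : ∑ i, μ i = n) {E : Op d n}
    (hE : E.PosSemidef) : prob E (rhoEq d n) / multinom μ ≤ prob E (rhoNeq μ hμ) := by
  set R := rhoEq d n with hR
  set A := rhoNeq μ hμ with hA
  set r := R (blockWord μ hμ) (blockWord μ hμ) with hr
  set c := R (constWord d n) (constWord d n) with hc
  have hM : (multinom μ : ℂ) ≠ 0 := by exact_mod_cast (multinom_pos μ).ne'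
  have hr0 : r ≠ 0 := rhoEq_apply_self_ne_zero _
  have hcr : c = multinom μ * r := by
    have h : c * r = multinom μ * r ^ 2 := rhoEq_constWord_mul_eq μ hμ
    exact mul_right_cancel₀ hr0 (by rw [h]; ring)
  have hc0 : c ≠ 0 := by rw [hcr]; exact mul_ne_zero hM hr0
  have hcs : star c = c := congrFun (congrFun (rhoEq_conjTranspose d n) _) _
  have hRs : Rᴴ = R := rhoEq_conjTranspose d n
  have hAs : Aᴴ = A := rhoNeq_conjTranspose μ hμ
  have hrs : star r = r := congrFun (congrFun hRs _) _
  have hRR : R * R = c • R := (isInvariant_mix_haarU _).mul_rhoEq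
  have hAR : A * R = r • R := by
    have h : A * R = A (constWord d n) (constWord d n) • R := (isInvariant_mix_haarU _).mul_rhoEq
    rwa [hA, rhoNeq_constWord] at h
  have hRA : R * A = r • R := by
    have h := congrArg Matrix.conjTranspose hAR
    rwa [Matrix.conjTranspose_mul, Matrix.conjTranspose_smul, hRs, hAs, hrs] at h
  -- Since `R² = c R`, the operator `R / c` is a projection and `K` is its complement. As `r / c = 1
  -- / M`, the compression of `A` by `K` removes exactly `R / M`.
  set K : Op d n := 1 - c⁻¹ • R with hK
  have hKs : Kᴴ = K := by
    rw [hK, Matrix.conjTranspose_sub, Matrix.conjTranspose_one, Matrix.conjTranspose_smul, hRs,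
      star_inv₀, hcs]
  have hKAK : K * A * K = A - (multinom μ : ℂ)⁻¹ • R := by
    have h1 : K * A = A - (multinom μ : ℂ)⁻¹ • R := by
      rw [hK, Matrix.sub_mul, Matrix.one_mul, Matrix.smul_mul, hRA, smul_smul, hcr]
      congr 2
      field_simp
    have h2 : R * K = 0 := by
      rw [hK, Matrix.mul_sub, Matrix.mul_one, Matrix.mul_smul, hRR, smul_smul,
        inv_mul_cancel₀ hc0, one_smul, sub_self]
    rw [h1, Matrix.sub_mul, Matrix.smul_mul, h2, smul_zero, sub_zero, hK, Matrix.mul_sub,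
      Matrix.mul_one, Matrix.mul_smul, hAR, smul_smul, hcr]
    congr 2
    field_simp
  -- The compression is placed on the effect, so positivity is only needed for outcome probabilities
  -- in product states.
  have hpos : 0 ≤ prob (K * E * K) A := by
    have h := hE.conjTranspose_mul_mul_same K
    rw [hKs] at h
    exact prob_mix_nonneg (integrable_rotated _ _) (prob_rotated_nonneg h _)
  have h : prob (K * E * K) A = prob E A - prob E R / multinom μ := by
    rw [prob, Matrix.mul_assoc, Matrix.mul_assoc, Matrix.trace_mul_comm, Matrix.mul_assoc,
      hKAK, Matrix.mul_sub, Matrix.trace_sub, Matrix.mul_smul, Matrix.trace_smul, Complex.sub_re,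
      smul_eq_mul, ← Complex.ofReal_inv, Complex.re_ofReal_mul, prob, prob]
    ring
  linarith

theorem prob_rhoNeqPerm {d n : ℕ} (μ : Fin d → ℕ) (hμ : ∑ i, μ i = n) (E : Op d n) :
    prob E (rhoNeqPerm μ hμ) = (n.factorial : ℝ)⁻¹ * ∑ π : Equiv.Perm (Fin n),
      prob (permOp d π⁻¹ * E * permOp d π) (rhoNeq μ hμ) := by
  simp only [← prob_conj_permOp]
  simp only [prob, rhoNeqPerm, Matrix.mul_smul, Matrix.trace_smul, Finset.mul_sum,
    Matrix.trace_sum, smul_eq_mul, ← Complex.re_sum]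
  rw [← Complex.re_ofReal_mul, Finset.mul_sum]
  simp

theorem prob_rhoNeqPerm_eq {d n : ℕ} (μ : Fin d → ℕ) (hμ : ∑ i, μ i = n) {E : Op d n} {c : ℝ}
    (h : ∀ π : Equiv.Perm (Fin n),
      prob (permOp d π⁻¹ * E * permOp d π) (rhoNeq μ hμ) = c) :
    prob E (rhoNeqPerm μ hμ) = c := by
  have h0 : (n.factorial : ℝ) ≠ 0 := by exact_mod_cast n.factorial_ne_zero
  simp [prob_rhoNeqPerm, h, Fintype.card_perm, h0]

/-- Each term is the ordered bound for the conjugated effect, and conjugation does not change `Tr[E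
R]` because permutations fix `R`. -/
theorem prob_rhoNeqPerm_ge {d n : ℕ} [NeZero d] (μ : Fin d → ℕ) (hμ : ∑ i, μ i = n) {E : Op d n}
    (hE : E.PosSemidef) : prob E (rhoEq d n) / multinom μ ≤ prob E (rhoNeqPerm μ hμ) := by
  have h0 : (n.factorial : ℝ) ≠ 0 := by exact_mod_cast n.factorial_ne_zero
  have h : ∀ π : Equiv.Perm (Fin n), prob E (rhoEq d n) / multinom μ ≤
      prob (permOp d π⁻¹ * E * permOp d π) (rhoNeq μ hμ) := fun π => by
    have h1 := prob_rhoNeq_ge μ hμ (posSemidef_conj_permOp hE π)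
    rwa [← prob_conj_permOp, permOp_mul_rhoEq, rhoEq_mul_permOp] at h1
  rw [prob_rhoNeqPerm]
  calc prob E (rhoEq d n) / multinom μ
      = (n.factorial : ℝ)⁻¹ * ∑ _π : Equiv.Perm (Fin n), prob E (rhoEq d n) / multinom μ := by
        simp [Fintype.card_perm, h0]
    _ ≤ _ := by gcongr with π _; exact h π

/-! ### Optimal tests -/

theorem prob_symProj_rotated_constWord {d n : ℕ} [NeZero d] (U : UGroup d) :
    prob (symProj d n) (rotated (constWord d n) U) = 1 := by
  rw [prob, symProj_mul_eq fun π => permOp_mul_rotated_constWord π U, trace_rotated,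
    Complex.one_re]

theorem prob_symProj_rotated_blockWord {d n : ℕ} (μ : Fin d → ℕ) (hμ : ∑ i, μ i = n)
    (U : UGroup d) : prob (symProj d n) (rotated (blockWord μ hμ) U) = 1 / multinom μ := by
  rw [prob, trace_mul_rotated, Matrix.mul_assoc, symProj_mul_tensorPow, ← Matrix.mul_assoc,
    tensorPow_conjTranspose_mul_self, Matrix.one_mul, symProj_blockWord, Complex.ofReal_re,
    one_div]

theorem permOp_conj_symProj (d : ℕ) {n : ℕ} (π : Equiv.Perm (Fin n)) :
    permOp d π⁻¹ * symProj d n * permOp d π = symProj d n := by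
  rw [permOp_mul_symProj, symProj_mul_permOp]

theorem trace_conj_permOp {d n : ℕ} (ρ : Op d n) (π : Equiv.Perm (Fin n)) :
    (permOp d π * ρ * permOp d π⁻¹).trace = ρ.trace := by
  rw [Matrix.trace_mul_comm, ← Matrix.mul_assoc, permOp_inv_mul_permOp, Matrix.one_mul]

/-- What the tests `Π_(n)` and `0` do on a family of scenarios, together with the bounds that hold
for every test. In the scenario `i₀`, the probability of the outcome "equal" in the state `ρ_≠` is
at least `1 / M` times that in the state `ρ₌`, whatever the test. -/
structure IsRegular {ι : Type} {d n : ℕ} (M : ℝ) (S : ι → Op d n × Op d n) (i₀ : ι) : Prop where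
  symProj_fst : ∀ i, prob (symProj d n) (S i).1 = 1
  symProj_snd : ∀ i, prob (symProj d n) (S i).2 = 1 / M
  trace_fst : ∀ i, (S i).1.trace.re = 1
  trace_snd : ∀ i, (S i).2.trace.re = 1
  fst_nonneg : ∀ E : Op d n, E.PosSemidef → ∀ i, 0 ≤ prob E (S i).1
  snd_nonneg : ∀ E : Op d n, E.PosSemidef → ∀ i, 0 ≤ prob E (S i).2
  le_snd : ∀ E : Op d n, E.PosSemidef → prob E (S i₀).1 / M ≤ prob E (S i₀).2

namespace IsRegular

variable {ι : Type} {d n : ℕ} {M p : ℝ} {S : ι → Op d n × Op d n} {i₀ : ι}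

theorem value_le (h : IsRegular M S i₀) (hp0 : 0 ≤ p) (hp1 : p ≤ 1) {F : Op d n} (hF : IsTest F) :
    value p S F ≤ (1 - p) + (p - (1 - p) / M) * prob F (S i₀).1 := by
  -- A real infimum is below each member only for a family bounded below.
  have hb : BddBelow (Set.range fun i => success p (S i).1 (S i).2 F) := by
    refine ⟨0, ?_⟩
    rintro _ ⟨i, rfl⟩
    exact add_nonneg (mul_nonneg hp0 (h.fst_nonneg F hF.1 i))
      (mul_nonneg (sub_nonneg.2 hp1) (h.snd_nonneg _ hF.2 i))
  refine (ciInf_le hb i₀).trans ?_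
  have h1 := mul_le_mul_of_nonneg_left (h.le_snd F hF.1) (sub_nonneg.2 hp1)
  have h2 : (1 - p) / M * prob F (S i₀).1 = (1 - p) * (prob F (S i₀).1 / M) := by ring
  rw [success, prob_one_sub, h.trace_snd]
  linarith

theorem prob_fst_mem (h : IsRegular M S i₀) {F : Op d n} (hF : IsTest F) :
    0 ≤ prob F (S i₀).1 ∧ prob F (S i₀).1 ≤ 1 := by
  have h1 := h.fst_nonneg _ hF.2 i₀
  rw [prob_one_sub, h.trace_fst] at h1
  exact ⟨h.fst_nonneg _ hF.1 i₀, by linarith⟩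

theorem isOptimalWith_symProj (h : IsRegular M S i₀) (hM : 0 < M) (hp1 : p ≤ 1)
    (hp : 1 / (1 + M) ≤ p) :
    IsOptimalWith p S (symProj d n) (1 - (1 - p) / M) 1 (1 - 1 / M) := by
  have hp0 : 0 ≤ p := le_trans (by positivity) hp
  have hs : ∀ i, success p (S i).1 (S i).2 (symProj d n) = 1 - (1 - p) / M := fun i => by
    rw [success, prob_one_sub, h.trace_snd, h.symProj_fst, h.symProj_snd]
    ring
  have hv : value p S (symProj d n) = 1 - (1 - p) / M := by
    have : Nonempty ι := ⟨i₀⟩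
    simp only [value, hs, ciInf_const]
  -- The threshold `1 / (1 + M)` is the solution of `p = (1 - p) / M`.
  have hc : 0 ≤ p - (1 - p) / M := by
    rw [div_le_iff₀ (by positivity)] at hp
    rw [sub_nonneg, div_le_iff₀ hM]
    linarith
  refine ⟨isTest_symProj d n, fun F hF => ?_, hv, hs, h.symProj_fst, fun i => ?_⟩
  · rw [hv]
    have h1 := h.value_le hp0 hp1 hF
    have h2 := mul_le_mul_of_nonneg_left (h.prob_fst_mem hF).2 hc
    linarith
  · rw [prob_one_sub, h.trace_snd, h.symProj_snd]

theorem isOptimalWith_zero (h : IsRegular M S i₀) (hM : 0 < M) (hp0 : 0 ≤ p) (hp1 : p ≤ 1)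
    (hp : p ≤ 1 / (1 + M)) : IsOptimalWith p S 0 (1 - p) 0 1 := by
  have hs : ∀ i, success p (S i).1 (S i).2 0 = 1 - p := fun i => by
    rw [success, prob_one_sub, h.trace_snd, prob_zero, prob_zero]
    ring
  have hv : value p S 0 = 1 - p := by
    have : Nonempty ι := ⟨i₀⟩
    simp only [value, hs, ciInf_const]
  have hc : p - (1 - p) / M ≤ 0 := by
    rw [le_div_iff₀ (by positivity)] at hp
    rw [sub_nonpos, le_div_iff₀ hM]
    linarith
  refine ⟨isTest_zero d n, fun F hF => ?_, hv, hs, fun i => prob_zero _, fun i => ?_⟩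
  · rw [hv]
    have h1 := h.value_le hp0 hp1 hF
    have h2 := mul_nonpos_of_nonpos_of_nonneg hc (h.prob_fst_mem hF).1
    linarith
  · rw [prob_one_sub, h.trace_snd, prob_zero, sub_zero]

end IsRegular

theorem IsOptimalWith.optValue_eq {ι : Type} {d n : ℕ} {p : ℝ} {S : ι → Op d n × Op d n}
    {E : Op d n} {Psucc Pc Ps : ℝ} (h : IsOptimalWith p S E Psucc Pc Ps) :
    optValue p S = Psucc := by
  rw [← h.value_eq]
  have : Nonempty {E : Op d n // IsTest E} := ⟨⟨E, h.isTest⟩⟩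
  refine le_antisymm (ciSup_le fun F => h.optimal F.1 F.2) ?_
  refine le_ciSup (f := fun F : {E : Op d n // IsTest E} => value p S F.1) ?_ ⟨E, h.isTest⟩
  -- Optimality itself supplies the upper bound that the real supremum requires.
  exact ⟨value p S E, by rintro _ ⟨F, rfl⟩; exact h.optimal F.1 F.2⟩

/-! ### The four problems -/

theorem isProbabilityMeasure_map_prodMk_one (d n : ℕ) :
    IsProbabilityMeasure ((haarU d).map fun U => (U, (1 : Equiv.Perm (Fin n)))) :=
  Measure.isProbabilityMeasure_map measurable_prodMk_right.aemeasurable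

/-- A Haar-random unitary and the identity permutation. -/
noncomputable def haarProdOne (d n : ℕ) : ProbabilityMeasure (UGroup d × Equiv.Perm (Fin n)) :=
  ⟨(haarU d).map fun U => (U, 1), isProbabilityMeasure_map_prodMk_one d n⟩

theorem integrable_rotated_fst {d n : ℕ}
    (q : Measure (UGroup d × Equiv.Perm (Fin n))) [IsFiniteMeasure q] (w x y : Fin n → Fin d) :
    Integrable (fun ω : UGroup d × Equiv.Perm (Fin n) => rotated w ω.1 x y) q :=
  integrable_of_continuous_left q fun _ => continuous_rotated_apply w x y

theorem integrable_conj_rotated {d n : ℕ}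
    (q : Measure (UGroup d × Equiv.Perm (Fin n))) [IsFiniteMeasure q] (w x y : Fin n → Fin d) : Integrable (fun ω : UGroup d × Equiv.Perm (Fin n) =>
      (permOp d ω.2 * rotated w ω.1 * permOp d ω.2⁻¹) x y) q :=
  integrable_of_continuous_left q fun σ => by
    simp only [mul_permOp_apply, permOp_mul_apply]
    exact continuous_rotated_apply w _ _

theorem mix_haarProdOne {d n : ℕ} {f : UGroup d × Equiv.Perm (Fin n) → Op d n}
    (hf : ∀ x y, Integrable (fun ω => f ω x y) (haarProdOne d n : Measure _)) :
    mix (haarProdOne d n : Measure (UGroup d × Equiv.Perm (Fin n))) f =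
      mix (haarU d) fun U => f (U, 1) := by
  ext x y
  exact integral_map measurable_prodMk_right.aemeasurable (hf x y).aestronglyMeasurable

section Problems

variable {d n : ℕ} [NeZero d] (μ : Fin d → ℕ) (hμ : ∑ i, μ i = n)

theorem isRegular_unknownOrdered :
    IsRegular (multinom μ) (unknownOrdered μ hμ) ⟨haarU d, inferInstance⟩ where
  symProj_fst _ := prob_mix_eq (integrable_rotated _ _) prob_symProj_rotated_constWord
  symProj_snd _ := prob_mix_eq (integrable_rotated _ _) (prob_symProj_rotated_blockWord μ hμ)
  trace_fst _ := congrArg Complex.re (trace_mix_eq_one (integrable_rotated _ _) (trace_rotated _))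
  trace_snd _ := congrArg Complex.re (trace_mix_eq_one (integrable_rotated _ _) (trace_rotated _))
  fst_nonneg _ hE _ := prob_mix_nonneg (integrable_rotated _ _) (prob_rotated_nonneg hE _)
  snd_nonneg _ hE _ := prob_mix_nonneg (integrable_rotated _ _) (prob_rotated_nonneg hE _)
  le_snd _ hE := prob_rhoNeq_ge μ hμ hE

/-- The random problem is, by definition, the scenario `q = haarU d` of the unknown one. -/
theorem isRegular_haarOrdered : IsRegular (multinom μ) (haarOrdered μ hμ) () where
  symProj_fst _ := (isRegular_unknownOrdered μ hμ).symProj_fst ⟨haarU d, inferInstance⟩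
  symProj_snd _ := (isRegular_unknownOrdered μ hμ).symProj_snd ⟨haarU d, inferInstance⟩
  trace_fst _ := (isRegular_unknownOrdered μ hμ).trace_fst ⟨haarU d, inferInstance⟩
  trace_snd _ := (isRegular_unknownOrdered μ hμ).trace_snd ⟨haarU d, inferInstance⟩
  fst_nonneg E hE _ := (isRegular_unknownOrdered μ hμ).fst_nonneg E hE ⟨haarU d, inferInstance⟩
  snd_nonneg E hE _ := (isRegular_unknownOrdered μ hμ).snd_nonneg E hE ⟨haarU d, inferInstance⟩
  le_snd := (isRegular_unknownOrdered μ hμ).le_snd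

theorem isRegular_haarPermuted : IsRegular (multinom μ) (haarPermuted μ hμ) () where
  symProj_fst := (isRegular_haarOrdered μ hμ).symProj_fst
  symProj_snd i := prob_rhoNeqPerm_eq μ hμ fun π => by
    rw [permOp_conj_symProj]
    exact (isRegular_haarOrdered μ hμ).symProj_snd i
  trace_fst := (isRegular_haarOrdered μ hμ).trace_fst
  trace_snd i := by
    have h : prob 1 (rhoNeqPerm μ hμ) = 1 := prob_rhoNeqPerm_eq μ hμ fun π => by
      rw [Matrix.mul_one, permOp_inv_mul_permOp, prob, Matrix.one_mul]
      exact (isRegular_haarOrdered μ hμ).trace_snd i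
    rwa [prob, Matrix.one_mul] at h
  fst_nonneg := (isRegular_haarOrdered μ hμ).fst_nonneg
  snd_nonneg E hE i := by
    change 0 ≤ prob E (rhoNeqPerm μ hμ)
    rw [prob_rhoNeqPerm]
    exact mul_nonneg (by positivity) (Finset.sum_nonneg fun π _ =>
      (isRegular_haarOrdered μ hμ).snd_nonneg _ (posSemidef_conj_permOp hE π) i)
  le_snd _ hE := prob_rhoNeqPerm_ge μ hμ hE

/-- The scenario with the identity permutation reproduces the Haar-random states in known positions,
so the ordered bound applies unchanged. Conjugation by permutations leaves `Π` fixed, so its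
probabilities are the same in every scenario. -/
theorem isRegular_unknownPermuted :
    IsRegular (multinom μ) (unknownPermuted μ hμ) (haarProdOne d n) where
  symProj_fst _ := prob_mix_eq (integrable_rotated_fst _ _) fun ω =>
    prob_symProj_rotated_constWord ω.1
  symProj_snd _ := prob_mix_eq (integrable_conj_rotated _ _) fun ω => by
    rw [prob_conj_permOp, permOp_conj_symProj, prob_symProj_rotated_blockWord]
  trace_fst _ := congrArg Complex.re
    (trace_mix_eq_one (integrable_rotated_fst _ _) fun ω => trace_rotated _ ω.1)
  trace_snd _ := congrArg Complex.re (trace_mix_eq_one (integrable_conj_rotated _ _) fun ω => by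
    rw [trace_conj_permOp, trace_rotated])
  fst_nonneg _ hE _ := prob_mix_nonneg (integrable_rotated_fst _ _) fun ω =>
    prob_rotated_nonneg hE _ ω.1
  snd_nonneg _ hE _ := prob_mix_nonneg (integrable_conj_rotated _ _) fun ω => by
    rw [prob_conj_permOp]
    exact prob_rotated_nonneg (posSemidef_conj_permOp hE _) _ _
  le_snd E hE := by
    have h := prob_rhoNeq_ge μ hμ hE
    have h1 : (unknownPermuted μ hμ (haarProdOne d n)).1 = rhoEq d n :=
      mix_haarProdOne (integrable_rotated_fst _ _)
    have h2 : (unknownPermuted μ hμ (haarProdOne d n)).2 = rhoNeq μ hμ := by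
      refine (mix_haarProdOne (integrable_conj_rotated _ _)).trans ?_
      simp only [inv_one, permOp_one, Matrix.one_mul, Matrix.mul_one]
      rfl
    rwa [h1, h2]

end Problems

end QSI

theorem corollary4p4 {d n : ℕ} [NeZero d] (μ : Fin d → ℕ) (hμ : ∑ i, μ i = n)
    (hμ2 : ∃ i j, i ≠ j ∧ 0 < μ i ∧ 0 < μ j) (p : ℝ) (hp0 : 0 ≤ p) (hp1 : p ≤ 1) :
    -- for large priors the permutation test is optimal, for permuted and for ordered inputs
    (QSI.pStar μ ≤ p →
      QSI.IsOptimalWith p (QSI.haarPermuted μ hμ) (QSI.symProj d n)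
        (1 - (1 - p) / QSI.multinom μ) 1 (1 - 1 / QSI.multinom μ) ∧
      QSI.IsOptimalWith p (QSI.unknownPermuted μ hμ) (QSI.symProj d n)
        (1 - (1 - p) / QSI.multinom μ) 1 (1 - 1 / QSI.multinom μ) ∧
      QSI.IsOptimalWith p (QSI.haarOrdered μ hμ) (QSI.symProj d n)
        (1 - (1 - p) / QSI.multinom μ) 1 (1 - 1 / QSI.multinom μ) ∧
      QSI.IsOptimalWith p (QSI.unknownOrdered μ hμ) (QSI.symProj d n)
        (1 - (1 - p) / QSI.multinom μ) 1 (1 - 1 / QSI.multinom μ)) ∧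
    -- for small priors the test that always answers "not equal" is optimal, for both
    (p ≤ QSI.pStar μ →
      QSI.IsOptimalWith p (QSI.haarPermuted μ hμ) 0 (1 - p) 0 1 ∧
      QSI.IsOptimalWith p (QSI.unknownPermuted μ hμ) 0 (1 - p) 0 1 ∧
      QSI.IsOptimalWith p (QSI.haarOrdered μ hμ) 0 (1 - p) 0 1 ∧
      QSI.IsOptimalWith p (QSI.unknownOrdered μ hμ) 0 (1 - p) 0 1) ∧
    -- knowing the positions gives no advantage
    QSI.optValue p (QSI.haarPermuted μ hμ) = QSI.optValue p (QSI.haarOrdered μ hμ) ∧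
    QSI.optValue p (QSI.unknownPermuted μ hμ) = QSI.optValue p (QSI.unknownOrdered μ hμ) := by
  have hM := QSI.multinom_pos μ
  have h1 := QSI.isRegular_haarPermuted μ hμ
  have h2 := QSI.isRegular_unknownPermuted μ hμ
  have h3 := QSI.isRegular_haarOrdered μ hμ
  have h4 := QSI.isRegular_unknownOrdered μ hμ
  refine ⟨fun h => ⟨h1.isOptimalWith_symProj hM hp1 h, h2.isOptimalWith_symProj hM hp1 h,
    h3.isOptimalWith_symProj hM hp1 h, h4.isOptimalWith_symProj hM hp1 h⟩,
    fun h => ⟨h1.isOptimalWith_zero hM hp0 hp1 h, h2.isOptimalWith_zero hM hp0 hp1 h,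
      h3.isOptimalWith_zero hM hp0 hp1 h, h4.isOptimalWith_zero hM hp0 hp1 h⟩, ?_⟩
  rcases le_total (QSI.pStar μ) p with h | h
  · exact ⟨(h1.isOptimalWith_symProj hM hp1 h).optValue_eq.trans
      (h3.isOptimalWith_symProj hM hp1 h).optValue_eq.symm,
      (h2.isOptimalWith_symProj hM hp1 h).optValue_eq.trans
      (h4.isOptimalWith_symProj hM hp1 h).optValue_eq.symm⟩
  · exact ⟨(h1.isOptimalWith_zero hM hp0 hp1 h).optValue_eq.trans
      (h3.isOptimalWith_zero hM hp0 hp1 h).optValue_eq.symm,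
      (h2.isOptimalWith_zero hM hp0 hp1 h).optValue_eq.trans
      (h4.isOptimalWith_zero hM hp0 hp1 h).optValue_eq.symm⟩
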